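/- Let $\mathrm{SO}(3)$ be the group of real orthogonal $3\times 3$ matrices of determinant $1$, with Haar measure $\mu$ of total mass $1$, let $\mathbb T=\mathbb R/2\pi\mathbb Z$, and let $R(\alpha,\beta,\gamma)=R_z(\alpha)R_y(\beta)R_z(\gamma)$, where $R_z(\theta)$ and $R_y(\theta)$ denote the rotations by the angle $\theta$ about the $z$-axis and the $y$-axis. Every rotation is of this form with $\beta\in[0,\pi]$. Let $\phi_{\mathrm{SO}(3)}\colon\mathbb T^3\to\mathrm{SO}(3)$ be the map $(\alpha,\beta,\gamma)\mapsto R(\alpha,\beta,\gamma)$. For $n\in\mathbb N_0$ and integers $k,l$ with $|k|,|l|\le n$, let $D_n^{k,l}\colon\mathrm{SO}(3)\to\mathbb C$ be the $L^2$-normalized Wigner-D function, $$D_n^{k,l}(R(\alpha,\beta,\gamma))=\sqrt{2n+1}\,e^{-ik\alpha}\,d_n^{k,l}(\cos\beta)\,e^{-il\gamma}\qquad(\alpha,\gamma\in\mathbb R,\ \beta\in[0,\pi]),$$ $$d_n^{k,l}(x)=(-1)^{\nu}\binom{2n-r}{r+a}^{1/2}\binom{r+b}{b}^{-1/2}\Big(\frac{1-x}{2}\Big)^{a/2}\Big(\frac{1+x}{2}\Big)^{b/2}P_r^{(a,b)}(x),$$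 where $a=|k-l|$, $b=|k+l|$, $r=n-\max\{|k|,|l|\}$, $\nu=k+l$ if $k>l$ and $\nu=0$ otherwise, and $P_r^{(a,b)}$ is the Jacobi polynomial. For a real number $s$, let $H^s(\mathrm{SO}(3))$ be the set of all $f\in L^2(\mathrm{SO}(3),\mu)$ with $$\sum_{n=0}^{\infty}\sum_{k,l=-n}^{n}(1+n(n+1))^{s}\,\big|\hat f_n^{k,l}\big|^2<\infty,\qquad \hat f_n^{k,l}=\int_{\mathrm{SO}(3)}f\,\overline{D_n^{k,l}}\,d\mu .$$ **Lemma.** Let $f\colon\mathrm{SO}(3)\to\mathbb C$ be the function given, for $\alpha,\gamma\in\mathbb R$ and $\beta\in[0,\pi]$, by $$f(R(\alpha,\beta,\gamma))=\begin{cases}\dfrac{1}{\sqrt{\sin\beta}},&\beta\notin\{0,\pi\},\\[1ex]0,&\text{otherwise.}\end{cases}$$ Then $f\in H^s(\mathrm{SO}(3))$ for every $s<\tfrac12$, and $f\circ\phi_{\mathrm{SO}(3)}\notin L^2(\mathbb T^3)$. -/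

import Mathlib

open MeasureTheory

noncomputable section

namespace RotDFS

/-- The rotation group `SO(3) = {R ∈ ℝ^{3×3} | Rᵀ R = 1, det R = 1}`, with the topology of
entrywise convergence. -/
abbrev SO3 : Type := Matrix.specialOrthogonalGroup (Fin 3) ℝ

/-- The circle `𝕋 = ℝ / 2πℤ`. -/
abbrev 𝕋 : Type := Real.Angle

theorem mem_SO3_iff {A : Matrix (Fin 3) (Fin 3) ℝ} :
    A ∈ Matrix.specialOrthogonalGroup (Fin 3) ℝ ↔ A.transpose * A = 1 ∧ A.det = 1 := by
  rw [Matrix.mem_specialOrthogonalGroup_iff, Matrix.mem_orthogonalGroup_iff']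

theorem coe_inv_SO3 (R : SO3) :
    ((R⁻¹ : SO3) : Matrix (Fin 3) (Fin 3) ℝ) = (R : Matrix (Fin 3) (Fin 3) ℝ).transpose := rfl

instance : IsTopologicalGroup SO3 where
  continuous_inv := by
    rw [continuous_induced_rng]
    exact (continuous_subtype_val (p := fun A => A ∈ Matrix.specialOrthogonalGroup (Fin 3) ℝ)
      ).matrix_transpose

theorem isClosed_SO3 :
    IsClosed {A : Matrix (Fin 3) (Fin 3) ℝ | A ∈ Matrix.specialOrthogonalGroup (Fin 3) ℝ} := by
  have h : {A : Matrix (Fin 3) (Fin 3) ℝ | A ∈ Matrix.specialOrthogonalGroup (Fin 3) ℝ} =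
      {A | A.transpose * A = 1} ∩ {A | A.det = 1} := by
    ext A; exact mem_SO3_iff
  rw [h]
  exact (isClosed_eq (by fun_prop) continuous_const).inter
    (isClosed_eq (by fun_prop) continuous_const)

theorem abs_apply_le_one (R : SO3) (i j : Fin 3) : |R.1 i j| ≤ 1 := by
  have h := congrFun (congrFun (mem_SO3_iff.1 R.2).1 j) j
  simp only [Matrix.mul_apply, Matrix.transpose_apply, Fin.sum_univ_three, Matrix.one_apply_eq] at h
  rw [abs_le_one_iff_mul_self_le_one]
  fin_cases i <;> simp only [Fin.zero_eta, Fin.mk_one, Fin.reduceFinMk] <;>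
    nlinarith [mul_self_nonneg (R.1 0 j), mul_self_nonneg (R.1 1 j), mul_self_nonneg (R.1 2 j)]

instance : CompactSpace SO3 := by
  refine isCompact_iff_compactSpace.1 ?_
  have hK : IsCompact (Set.univ.pi fun _ : Fin 3 => Set.univ.pi fun _ : Fin 3 =>
      Set.Icc (-1 : ℝ) 1) :=
    isCompact_univ_pi fun _ => isCompact_univ_pi fun _ => isCompact_Icc
  refine hK.of_isClosed_subset isClosed_SO3 ?_
  intro A hA i _ j _
  exact abs_le.1 (abs_apply_le_one ⟨A, hA⟩ i j)

instance : MeasurableSpace SO3 := borel SO3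

instance : BorelSpace SO3 := ⟨rfl⟩

/-- The Haar measure of `SO(3)`, normalized to total mass `1`. -/
def haarSO3 : Measure SO3 := Measure.haarMeasure ⊤

/-- The Lebesgue measure on `𝕋 = ℝ / 2πℤ`, of total mass `2π`. -/
instance : MeasureSpace 𝕋 :=
  @AddCircle.measureSpace (2 * Real.pi) ⟨Real.two_pi_pos⟩

instance : BorelSpace 𝕋 :=
  inferInstanceAs (BorelSpace (AddCircle (2 * Real.pi)))

/-- Rotation by the angle `θ` about the `z`-axis. -/
def rotZ (θ : 𝕋) : SO3 :=
  ⟨!![θ.cos, -θ.sin, 0; θ.sin, θ.cos, 0; 0, 0, 1], by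
    have h := θ.cos_sq_add_sin_sq
    rw [mem_SO3_iff]
    constructor
    · ext i j
      fin_cases i <;> fin_cases j <;> simp [Matrix.mul_apply, Fin.sum_univ_three] <;> linarith
    · simp [Matrix.det_fin_three]; linarith⟩

/-- Rotation by the angle `θ` about the `y`-axis. -/
def rotY (θ : 𝕋) : SO3 :=
  ⟨!![θ.cos, 0, θ.sin; 0, 1, 0; -θ.sin, 0, θ.cos], by
    have h := θ.cos_sq_add_sin_sq
    rw [mem_SO3_iff]
    constructor
    · ext i j
      fin_cases i <;> fin_cases j <;> simp [Matrix.mul_apply, Fin.sum_univ_three] <;> linarith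
    · simp [Matrix.det_fin_three]; linarith⟩

/-- `R(α, β, γ) = R_z(α) R_y(β) R_z(γ)`. -/
def eulerRotation (α β γ : 𝕋) : SO3 := rotZ α * rotY β * rotZ γ

/-- The Euler angle parametrization `φ : 𝕋³ → SO(3)`, `φ(α, β, γ) = R(α, β, γ)`. -/
def phiSO3 (x : 𝕋 × 𝕋 × 𝕋) : SO3 := eulerRotation x.1 x.2.1 x.2.2

theorem eulerRotation_val (α β γ : 𝕋) :
    (eulerRotation α β γ).1 =
      !![α.cos * β.cos * γ.cos - α.sin * γ.sin, -(α.cos * β.cos * γ.sin) - α.sin * γ.cos,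
          α.cos * β.sin;
        α.sin * β.cos * γ.cos + α.cos * γ.sin, -(α.sin * β.cos * γ.sin) + α.cos * γ.cos,
          α.sin * β.sin;
        -(β.sin * γ.cos), β.sin * γ.sin, β.cos] := by
  have : (eulerRotation α β γ).1 = (rotZ α).1 * (rotY β).1 * (rotZ γ).1 := rfl
  rw [this]
  ext i j
  fin_cases i <;> fin_cases j <;>
    simp [rotZ, rotY, Matrix.mul_apply, Fin.sum_univ_three] <;> ring

theorem exists_angle (x y r : ℝ) (hr : 0 ≤ r) (h : x ^ 2 + y ^ 2 = r ^ 2) :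
    ∃ θ : ℝ, x = r * Real.cos θ ∧ y = r * Real.sin θ := by
  refine ⟨Complex.arg ⟨x, y⟩, ?_⟩
  have hn : ‖(⟨x, y⟩ : ℂ)‖ = r := by
    rw [Complex.norm_eq_sqrt_sq_add_sq, h, Real.sqrt_sq hr]
  constructor
  · rw [← hn, Complex.norm_mul_cos_arg]
  · rw [← hn, Complex.norm_mul_sin_arg]

theorem exists_rotZ (M : SO3) (h0 : M.1 0 2 = 0) (h1 : M.1 1 2 = 0) (h2 : M.1 2 2 = 1) :
    ∃ γ : ℝ, rotZ (γ : 𝕋) = M := by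
  obtain ⟨ho, hd⟩ := mem_SO3_iff.1 M.2
  have e (i j : Fin 3) := congrFun (congrFun ho i) j
  simp only [Matrix.mul_apply, Matrix.transpose_apply, Fin.sum_univ_three] at e
  have e02 := e 0 2
  have e12 := e 1 2
  have e00 := e 0 0
  have e01 := e 0 1
  have e11 := e 1 1
  rw [Matrix.det_fin_three] at hd
  simp [h0, h1, h2] at e02 e12
  simp [e02, e12] at e00 e01 e11
  simp [h0, h1, h2, e02, e12] at hd
  obtain ⟨γ, hc, hs⟩ := exists_angle (M.1 0 0) (M.1 1 0) 1 zero_le_one (by linarith)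
  have k1 : M.1 0 1 = -M.1 1 0 := by
    linear_combination (-M.1 0 1) * e00 + M.1 0 0 * e01 - M.1 1 0 * hd
  have k2 : M.1 1 1 = M.1 0 0 := by
    linear_combination (-M.1 1 1) * e00 + M.1 1 0 * e01 + M.1 0 0 * hd
  rw [one_mul] at hc hs
  refine ⟨γ, Subtype.ext ?_⟩
  ext i j
  fin_cases i <;> fin_cases j <;>
    simp [rotZ, Real.Angle.cos_coe, Real.Angle.sin_coe, h0, h1, h2, e02, e12, k1, k2, hc, hs]

/-- Every rotation has Euler angles with `β ∈ [0, π]`. -/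
theorem exists_eulerAngles (R : SO3) : ∃ p : ℝ × ℝ × ℝ, p.2.1 ∈ Set.Icc 0 Real.pi ∧
    eulerRotation (p.1 : 𝕋) (p.2.1 : 𝕋) (p.2.2 : 𝕋) = R := by
  obtain ⟨ho, -⟩ := mem_SO3_iff.1 R.2
  have e := congrFun (congrFun ho 2) 2
  simp only [Matrix.mul_apply, Matrix.transpose_apply, Fin.sum_univ_three,
    Matrix.one_apply_eq] at e
  have hb := abs_le.1 (abs_apply_le_one R 2 2)
  set β := Real.arccos (R.1 2 2) with hβ
  have hc : Real.cos β = R.1 2 2 := Real.cos_arccos hb.1 hb.2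
  have hs : 0 ≤ Real.sin β :=
    Real.sin_nonneg_of_nonneg_of_le_pi (Real.arccos_nonneg _) (Real.arccos_le_pi _)
  have hcs := Real.sin_sq_add_cos_sq β
  obtain ⟨α, ha, ha'⟩ := exists_angle (R.1 0 2) (R.1 1 2) (Real.sin β) hs (by
    rw [hc] at hcs; linarith)
  have hαs := Real.sin_sq_add_cos_sq α
  have hM : ∀ i, ((rotZ (α : 𝕋) * rotY (β : 𝕋))⁻¹ * R).1 i 2 =
      ∑ j, ((rotZ (α : 𝕋)).1 * (rotY (β : 𝕋)).1) j i * R.1 j 2 := by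
    intro i
    have : ((rotZ (α : 𝕋) * rotY (β : 𝕋))⁻¹ * R).1 =
      ((rotZ (α : 𝕋)).1 * (rotY (β : 𝕋)).1).transpose * R.1 := rfl
    rw [this, Matrix.mul_apply]
    rfl
  obtain ⟨γ, hγ⟩ := exists_rotZ ((rotZ (α : 𝕋) * rotY (β : 𝕋))⁻¹ * R)
    (by
      rw [hM]
      simp [rotZ, rotY, Matrix.mul_apply, Fin.sum_univ_three, ← hc, ha, ha']
      linear_combination (Real.cos β * Real.sin β) * hαs)
    (by
      rw [hM]
      simp [rotZ, rotY, Matrix.mul_apply, Fin.sum_univ_three, ha, ha']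
      ring)
    (by
      rw [hM]
      simp [rotZ, rotY, Matrix.mul_apply, Fin.sum_univ_three, ← hc, ha, ha']
      linear_combination (Real.sin β) ^ 2 * hαs + hcs)
  refine ⟨(α, β, γ), ⟨Real.arccos_nonneg _, Real.arccos_le_pi _⟩, ?_⟩
  change rotZ (α : 𝕋) * rotY (β : 𝕋) * rotZ (γ : 𝕋) = R
  rw [hγ, mul_inv_cancel_left]

/-- Euler angles `(α, β, γ)` of a rotation, with `β ∈ [0, π]`. -/
def eulerAngles (R : SO3) : ℝ × ℝ × ℝ := (exists_eulerAngles R).choose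

theorem eulerAngles_mem (R : SO3) : (eulerAngles R).2.1 ∈ Set.Icc 0 Real.pi :=
  (exists_eulerAngles R).choose_spec.1

theorem eulerRotation_eulerAngles (R : SO3) :
    eulerRotation ((eulerAngles R).1 : 𝕋) ((eulerAngles R).2.1 : 𝕋) ((eulerAngles R).2.2 : 𝕋) = R :=
  (exists_eulerAngles R).choose_spec.2

/-- The Jacobi polynomial `P_s^{(a, b)}` for parameters `a, b ∈ ℕ`. -/
def jacobiP (s a b : ℕ) (x : ℝ) : ℝ :=
  ∑ m ∈ Finset.range (s + 1), ((s + a).choose (s - m) : ℝ) * ((s + b).choose m : ℝ) *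
    ((x - 1) / 2) ^ m * ((x + 1) / 2) ^ (s - m)

/-- The Wigner-d function `d_n^{k,l}` for `|k|, |l| ≤ n`. -/
def wignerd (n : ℕ) (k l : ℤ) (x : ℝ) : ℝ :=
  let a : ℕ := (k - l).natAbs
  let b : ℕ := (k + l).natAbs
  let s : ℕ := n - max k.natAbs l.natAbs
  let ν : ℤ := if l < k then k + l else 0
  (-1 : ℝ) ^ ν * √((2 * n - s).choose (s + a) : ℝ) * (√((s + b).choose b : ℝ))⁻¹ *
    ((1 - x) / 2) ^ ((a : ℝ) / 2) * ((1 + x) / 2) ^ ((b : ℝ) / 2) * jacobiP s a b x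

/-- `√(2n+1) e^{-ikα} d_n^{k,l}(cos β) e^{-ilγ}`. -/
def wignerDEuler (n : ℕ) (k l : ℤ) (α β γ : ℝ) : ℂ :=
  (√(2 * n + 1) : ℝ) * Complex.exp (-(Complex.I * k * α)) * (wignerd n k l (Real.cos β) : ℝ) *
    Complex.exp (-(Complex.I * l * γ))

/-- The `L²`-normalized Wigner-D function `D_n^{k,l}` on `SO(3)`. The value does not depend on the
choice of the Euler angles: see `wignerD_eulerRotation`. -/
def wignerD (n : ℕ) (k l : ℤ) (R : SO3) : ℂ :=
  wignerDEuler n k l (eulerAngles R).1 (eulerAngles R).2.1 (eulerAngles R).2.2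

theorem exp_eq_of_cos_sin {x y : ℝ} (hc : Real.cos x = Real.cos y) (hs : Real.sin x = Real.sin y)
    (k : ℤ) : Complex.exp (-(Complex.I * k * x)) = Complex.exp (-(Complex.I * k * y)) := by
  have h (z : ℝ) : Complex.exp (-(Complex.I * k * z)) =
      ((Real.cos z : ℂ) + (Real.sin z : ℂ) * Complex.I) ^ (-k) := by
    rw [Complex.ofReal_cos, Complex.ofReal_sin, ← Complex.exp_mul_I, ← Complex.exp_int_mul]
    congr 1
    push_cast
    ring
  rw [h, h, hc, hs]

theorem wignerd_one {n : ℕ} {k l : ℤ} (h : k ≠ l) : wignerd n k l 1 = 0 := by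
  have : (((k - l).natAbs : ℝ) / 2) ≠ 0 := by
    simpa [sub_eq_zero] using h
  simp only [wignerd, sub_self, zero_div, Real.zero_rpow this, mul_zero, zero_mul]

theorem wignerd_neg_one {n : ℕ} {k l : ℤ} (h : k + l ≠ 0) : wignerd n k l (-1) = 0 := by
  have : (((k + l).natAbs : ℝ) / 2) ≠ 0 := by
    rw [Ne, div_eq_zero_iff, Nat.cast_eq_zero, Int.natAbs_eq_zero]
    simpa using h
  simp only [wignerd, add_neg_cancel, zero_div, Real.zero_rpow this, mul_zero, zero_mul]

theorem wignerDEuler_congr (n : ℕ) (k l : ℤ) {α β γ α' β' γ' : ℝ} (hβ : β ∈ Set.Icc 0 Real.pi)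
    (hβ' : β' ∈ Set.Icc 0 Real.pi)
    (h : eulerRotation (α : 𝕋) (β : 𝕋) (γ : 𝕋) = eulerRotation (α' : 𝕋) (β' : 𝕋) (γ' : 𝕋)) :
    wignerDEuler n k l α β γ = wignerDEuler n k l α' β' γ' := by
  have hv := congrArg Subtype.val h
  rw [eulerRotation_val, eulerRotation_val] at hv
  have e (i j : Fin 3) := congrFun (congrFun hv i) j
  have h22 : Real.cos β = Real.cos β' := by simpa using e 2 2
  obtain rfl : β = β' := Real.injOn_cos hβ hβ' h22
  have h02 : Real.cos α * Real.sin β = Real.cos α' * Real.sin β := by simpa using e 0 2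
  have h12 : Real.sin α * Real.sin β = Real.sin α' * Real.sin β := by simpa using e 1 2
  have h20 : Real.sin β * Real.cos γ = Real.sin β * Real.cos γ' := by simpa using e 2 0
  have h21 : Real.sin β * Real.sin γ = Real.sin β * Real.sin γ' := by simpa using e 2 1
  have h00 : Real.cos α * Real.cos β * Real.cos γ - Real.sin α * Real.sin γ =
      Real.cos α' * Real.cos β * Real.cos γ' - Real.sin α' * Real.sin γ' := by simpa using e 0 0
  have h10 : Real.sin α * Real.cos β * Real.cos γ + Real.cos α * Real.sin γ =
      Real.sin α' * Real.cos β * Real.cos γ' + Real.cos α' * Real.sin γ' := by simpa using e 1 0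
  unfold wignerDEuler
  by_cases hs : Real.sin β = 0
  · have hcs := Real.sin_sq_add_cos_sq β
    rw [hs] at hcs
    have hc : (Real.cos β - 1) * (Real.cos β + 1) = 0 := by linear_combination hcs
    rcases mul_eq_zero.1 hc with hc | hc
    · replace hc : Real.cos β = 1 := by linarith
      rw [hc] at h00 h10 ⊢
      by_cases hkl : k = l
      · subst hkl
        have key := exp_eq_of_cos_sin (x := α + γ) (y := α' + γ')
          (by rw [Real.cos_add, Real.cos_add]; linarith)
          (by rw [Real.sin_add, Real.sin_add]; linarith) k
        push_cast at key
        rw [mul_add, mul_add, neg_add, neg_add, Complex.exp_add, Complex.exp_add] at key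
        linear_combination ((√(2 * n + 1) : ℝ) : ℂ) * ((wignerd n k k 1 : ℝ) : ℂ) * key
      · rw [wignerd_one hkl]; simp
    · replace hc : Real.cos β = -1 := by linarith
      rw [hc] at h00 h10 ⊢
      by_cases hkl : k + l = 0
      · obtain rfl : l = -k := by linarith
        have key := exp_eq_of_cos_sin (x := α - γ) (y := α' - γ')
          (by rw [Real.cos_sub, Real.cos_sub]; linarith)
          (by rw [Real.sin_sub, Real.sin_sub]; linarith) k
        have hk (z : ℝ) : Complex.exp (-(Complex.I * (-k : ℤ) * z)) =
            Complex.exp (Complex.I * k * z) := by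
          congr 1; push_cast; ring
        push_cast at key
        rw [mul_sub, mul_sub, neg_sub, neg_sub, sub_eq_add_neg, sub_eq_add_neg,
          Complex.exp_add, Complex.exp_add] at key
        rw [hk, hk]
        linear_combination ((√(2 * n + 1) : ℝ) : ℂ) * ((wignerd n k (-k) (-1) : ℝ) : ℂ) * key
      · rw [wignerd_neg_one hkl]; simp
  · rw [exp_eq_of_cos_sin (mul_right_cancel₀ hs h02) (mul_right_cancel₀ hs h12) k,
      exp_eq_of_cos_sin (mul_left_cancel₀ hs h20) (mul_left_cancel₀ hs h21) l]

theorem wignerD_eulerRotation (n : ℕ) (k l : ℤ) (α β γ : ℝ) (hβ : β ∈ Set.Icc 0 Real.pi) :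
    wignerD n k l (eulerRotation (α : 𝕋) (β : 𝕋) (γ : 𝕋)) = wignerDEuler n k l α β γ :=
  wignerDEuler_congr n k l (eulerAngles_mem _) hβ (eulerRotation_eulerAngles _)

/-- The harmonic coefficient `⟨f, D_n^{k,l}⟩ = ∫ f(R) conj(D_n^{k,l}(R)) dμ(R)`. -/
def harmCoeff (f : SO3 → ℂ) (n : ℕ) (k l : ℤ) : ℂ :=
  ∫ R, f R * (starRingEnd ℂ) (wignerD n k l R) ∂haarSO3

/-- The set `{(n, k, l) | n ∈ ℕ, k, l = -n, …, n}` of all harmonic indices. -/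
abbrev HarmIndex : Type := {p : ℕ × ℤ × ℤ // |p.2.1| ≤ (p.1 : ℤ) ∧ |p.2.2| ≤ (p.1 : ℤ)}

/-- `f ∈ H^s(SO(3))`: `f` is in `L²(SO(3))` and
`∑_{(n,k,l)} (1 + n(n+1))^s |⟨f, D_n^{k,l}⟩|² < ∞`. -/
def MemSobolevSO3 (s : ℝ) (f : SO3 → ℂ) : Prop :=
  MemLp f 2 haarSO3 ∧
    Summable fun p : HarmIndex =>
      (1 + (p.1.1 : ℝ) * (p.1.1 + 1)) ^ s * ‖harmCoeff f p.1.1 p.1.2.1 p.1.2.2‖ ^ 2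

end RotDFS

end

open RotDFS

noncomputable section

namespace RotDFS

open Polynomial

/-! With `x = cos β = R₂₂`, the function is zonal: `f(R) = w(R₂₂)` where `w(x) = (1 - x²)^(-1/4)`.
By Archimedes' theorem (`map_entry_haarSO3`) `R₂₂` is uniform on `[-1, 1]` under Haar measure, so
integrals of zonal functions become integrals in `x`. In particular `f ∈ L²` because `w² = (1 -
x²)^(-1/2)` is the derivative of `arcsin`.

Invariance of `f` under `z`-rotations on both sides kills every coefficient with `(k, l) ≠ (0, 0)`.
The remaining ones are `√(2n+1)/2 · Iₙ` with `Iₙ = ∫ w Pₙ`, `Pₙ` the Legendre polynomial.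
Integrating the derivative of `(1 - x²)^(3/4) Pₙ` and using the Legendre derivative identities gives
`(n+2)(n+5/2) Iₙ₊₂ = (n+1/2)(n+1) Iₙ` (`legendreIntegral_add_two`), whence `Iₙ = O(n^(-3/2))`. The
squared coefficients are `O(n⁻²)`, and `∑ n^(2s-2)` converges for `s < 1/2`.

On the torus the measure lacks the Jacobian factor `sin β`. There `|f ∘ φ|² = 1/|sin β|`, which is
not integrable near `β = 0`. -/

/-! ### Derivative identities for Legendre polynomials -/

theorem iterate_derivative_X_mul_succ (k : ℕ) (p : ℝ[X]) :
    derivative^[k + 1] (X * p) = X * derivative^[k + 1] p + ((k : ℝ[X]) + 1) * derivative^[k] p := by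
  rw [mul_comm X p, iterate_derivative_mul_X]
  simp [nsmul_eq_mul]; ring

/-- `2ⁿ n!` times the Legendre polynomial, by Rodrigues' formula. -/
def rodrigues (n : ℕ) : ℝ[X] := derivative^[n] ((X ^ 2 - 1) ^ n)

theorem derivative_X_sq_sub_one_pow (n : ℕ) :
    derivative ((X ^ 2 - 1 : ℝ[X]) ^ (n + 1)) =
      X * (C (2 * ((n : ℝ) + 1)) * (X ^ 2 - 1) ^ n) := by
  rw [derivative_pow]
  simp [map_ofNat C 2]; ring

theorem iterate_derivative_X_sq_sub_one_mul (n : ℕ) (p : ℝ[X]) :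
    derivative^[n + 2] ((X ^ 2 - 1) * p) = (X ^ 2 - 1) * derivative^[n + 2] p +
      2 * ((n : ℝ[X]) + 2) * X * derivative^[n + 1] p +
      ((n : ℝ[X]) + 2) * ((n : ℝ[X]) + 1) * derivative^[n] p := by
  have : (X ^ 2 - 1) * p = X * (X * p) - p := by ring
  rw [this, iterate_derivative_sub, iterate_derivative_X_mul_succ, iterate_derivative_X_mul_succ,
    iterate_derivative_X_mul_succ]
  push_cast; ring

/-- One derivative is spent on the power, the others follow Leibniz' rule for the factor `X`. The
cases `k = n` and `k + 1 = n` yield the two Legendre identities below. -/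
theorem iterate_derivative_X_sq_sub_one_pow_eq (n k : ℕ) :
    derivative^[k + 2] ((X ^ 2 - 1 : ℝ[X]) ^ (n + 1)) =
      2 * ((n : ℝ[X]) + 1) * (X * derivative^[k + 1] ((X ^ 2 - 1) ^ n) +
        ((k : ℝ[X]) + 1) * derivative^[k] ((X ^ 2 - 1) ^ n)) := by
  rw [Function.iterate_succ_apply, derivative_X_sq_sub_one_pow, iterate_derivative_X_mul_succ,
    iterate_derivative_C_mul, iterate_derivative_C_mul]
  simp [map_ofNat C 2]; ring

theorem derivative_rodrigues_succ (n : ℕ) :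
    derivative (rodrigues (n + 1)) =
      2 * ((n : ℝ[X]) + 1) * (X * derivative (rodrigues n) + ((n : ℝ[X]) + 1) * rodrigues n) := by
  simp only [rodrigues, ← Function.iterate_succ_apply']
  exact iterate_derivative_X_sq_sub_one_pow_eq n n

/-- For `n ≥ 1`, `rodrigues (n + 1)` is expanded in two ways: by differentiating the power once, and
by splitting off a factor `X² - 1`. Both expansions contain the `(n-1)`-st derivative of `(X² -
1)ⁿ`, which is eliminated between them. -/
theorem X_sq_sub_one_mul_derivative_rodrigues (n : ℕ) :
    2 * ((X ^ 2 - 1) * derivative (rodrigues n)) =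
      rodrigues (n + 1) - 2 * ((n : ℝ[X]) + 1) * X * rodrigues n := by
  rcases n with _ | m
  · simp [rodrigues, one_add_one_eq_two, map_ofNat C 2]
  · have h1 := iterate_derivative_X_sq_sub_one_pow_eq (m + 1) m
    have h2 := iterate_derivative_X_sq_sub_one_mul m ((X ^ 2 - 1) ^ (m + 1))
    rw [← pow_succ'] at h2
    simp only [rodrigues, ← Function.iterate_succ_apply']
    simp only [Nat.succ_eq_add_one, add_assoc, Nat.reduceAdd] at h1 h2 ⊢
    push_cast at h1 h2 ⊢
    linear_combination h1 - 2 * h2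

theorem X_sq_sub_one_mul_derivative_rodrigues_succ (n : ℕ) :
    (X ^ 2 - 1) * derivative (rodrigues (n + 1)) =
      ((n : ℝ[X]) + 1) * (X * rodrigues (n + 1) - 2 * ((n : ℝ[X]) + 1) * rodrigues n) := by
  linear_combination (X ^ 2 - 1) * derivative_rodrigues_succ n +
    ((n : ℝ[X]) + 1) * X * X_sq_sub_one_mul_derivative_rodrigues n

/-- Leibniz' rule for `(X - 1)ⁿ (X + 1)ⁿ` reproduces the explicit Jacobi sum term by term. -/
theorem eval_rodrigues (n : ℕ) (x : ℝ) :
    (rodrigues n).eval x = 2 ^ n * n.factorial * jacobiP n 0 0 x := by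
  have h : (X ^ 2 - 1 : ℝ[X]) ^ n = (X - C 1) ^ n * (X + C 1) ^ n := by
    rw [← mul_pow]; congr 1; simp; ring
  rw [rodrigues, h, iterate_derivative_mul, eval_finsetSum, jacobiP, Finset.mul_sum]
  refine Finset.sum_congr rfl fun m hm => ?_
  have hm' : m ≤ n := Nat.lt_succ_iff.1 (Finset.mem_range.1 hm)
  rw [iterate_derivative_X_sub_pow, iterate_derivative_X_add_pow, Nat.sub_sub_self hm']
  have e1 : (n.descFactorial (n - m) : ℝ) * m.factorial = n.factorial := by
    have := Nat.factorial_mul_descFactorial (Nat.sub_le n m)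
    rw [Nat.sub_sub_self hm'] at this
    rw [mul_comm]; exact_mod_cast this
  have e2 : (n.descFactorial m : ℝ) = m.factorial * n.choose m := by
    exact_mod_cast Nat.descFactorial_eq_factorial_mul_choose n m
  have e3 : (2 : ℝ) ^ n = 2 ^ m * 2 ^ (n - m) := by rw [← pow_add]; congr 1; omega
  simp only [nsmul_eq_mul, eval_mul, eval_natCast, eval_pow, eval_sub, eval_add, eval_X, eval_C,
    add_zero, Nat.choose_symm hm', div_pow, e2, e3, ← e1]
  field_simp

theorem hasDerivAt_jacobiP (n : ℕ) (x : ℝ) :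
    HasDerivAt (jacobiP n 0 0) (deriv (jacobiP n 0 0) x) x := by
  refine DifferentiableAt.hasDerivAt ?_
  unfold jacobiP
  fun_prop

theorem eval_derivative_rodrigues (n : ℕ) (x : ℝ) :
    (derivative (rodrigues n)).eval x = 2 ^ n * n.factorial * deriv (jacobiP n 0 0) x := by
  rw [← Polynomial.deriv, ← deriv_const_mul _ (hasDerivAt_jacobiP n x).differentiableAt]
  congr 1
  ext y
  exact eval_rodrigues n y

theorem one_sub_sq_mul_deriv_jacobiP (n : ℕ) (x : ℝ) :
    (1 - x ^ 2) * deriv (jacobiP n 0 0) x =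
      (n + 1) * (x * jacobiP n 0 0 x - jacobiP (n + 1) 0 0 x) := by
  have h := congrArg (eval x) (X_sq_sub_one_mul_derivative_rodrigues n)
  simp only [eval_mul, eval_sub, eval_add, eval_pow, eval_X, eval_one, eval_natCast, eval_ofNat,
    eval_rodrigues, eval_derivative_rodrigues, Nat.factorial_succ, pow_succ, Nat.cast_mul] at h
  have hc : (2 : ℝ) ^ n * n.factorial ≠ 0 := by positivity
  refine mul_left_cancel₀ hc ?_
  push_cast at h
  linear_combination (-1 / 2) * h

theorem one_sub_sq_mul_deriv_jacobiP_succ (n : ℕ) (x : ℝ) :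
    (1 - x ^ 2) * deriv (jacobiP (n + 1) 0 0) x =
      (n + 1) * (jacobiP n 0 0 x - x * jacobiP (n + 1) 0 0 x) := by
  have h := congrArg (eval x) (X_sq_sub_one_mul_derivative_rodrigues_succ n)
  simp only [eval_mul, eval_sub, eval_add, eval_pow, eval_X, eval_one, eval_natCast, eval_ofNat,
    eval_rodrigues, eval_derivative_rodrigues, Nat.factorial_succ, pow_succ, Nat.cast_mul] at h
  have hc : (2 : ℝ) ^ n * 2 * ((n + 1) * n.factorial) ≠ 0 := by positivity
  refine mul_left_cancel₀ hc ?_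
  push_cast at h
  linear_combination (-1) * h

/-! ### Haar measure on SO(3) and the distribution of `R₂₂` -/

instance : haarSO3.IsHaarMeasure := by unfold haarSO3; infer_instance

instance : IsProbabilityMeasure haarSO3 :=
  ⟨Measure.haarMeasure_self (K₀ := (⊤ : TopologicalSpace.PositiveCompacts SO3))⟩

/-- A right translate of the measure is again left invariant, hence a multiple of it by uniqueness;
total mass `1` forces the factor to be `1`. -/
instance : haarSO3.IsMulRightInvariant where
  map_mul_right_eq_self g := by
    have : IsProbabilityMeasure (haarSO3.map (· * g)) :=
      Measure.isProbabilityMeasure_map (measurable_mul_const g).aemeasurable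
    have h := Measure.isMulInvariant_eq_smul_of_compactSpace (haarSO3.map (· * g)) haarSO3
    have h1 := congrArg (· Set.univ) h
    simp only [measure_univ, Measure.smul_apply] at h1
    rw [h, ENNReal.smul_def]
    rw [ENNReal.smul_def, smul_eq_mul, mul_one] at h1
    rw [← h1, one_smul]

@[fun_prop]
theorem continuous_entry (i j : Fin 3) : Continuous fun R : SO3 => R.1 i j :=
  (continuous_subtype_val (p := fun A => A ∈ Matrix.specialOrthogonalGroup (Fin 3) ℝ)).matrix_elem
    i j

theorem integrable_haarSO3_of_continuous {F : SO3 → ℝ} (hF : Continuous F) :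
    Integrable F haarSO3 :=
  hF.integrable_of_hasCompactSupport (HasCompactSupport.of_compactSpace F)

theorem rotY_mul_zero_two (θ : ℝ) (R : SO3) :
    (rotY θ * R).1 0 2 = Real.cos θ * R.1 0 2 + Real.sin θ * R.1 2 2 := by
  change ((rotY θ).1 * R.1) 0 2 = _
  simp [rotY, Matrix.mul_apply, Fin.sum_univ_three]

theorem rotY_mul_two_two (θ : ℝ) (R : SO3) :
    (rotY θ * R).1 2 2 = -Real.sin θ * R.1 0 2 + Real.cos θ * R.1 2 2 := by
  change ((rotY θ).1 * R.1) 2 2 = _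
  simp [rotY, Matrix.mul_apply, Fin.sum_univ_three]

theorem rotZ_mul_two_two (θ : 𝕋) (R : SO3) : (rotZ θ * R).1 2 2 = R.1 2 2 := by
  change ((rotZ θ).1 * R.1) 2 2 = _
  simp [rotZ, Matrix.mul_apply, Fin.sum_univ_three]

theorem mul_rotZ_two_two (θ : 𝕋) (R : SO3) : (R * rotZ θ).1 2 2 = R.1 2 2 := by
  change (R.1 * (rotZ θ).1) 2 2 = _
  simp [rotZ, Matrix.mul_apply, Fin.sum_univ_three]

theorem rotZ_pi_div_two_mul_zero_two (R : SO3) :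
    (rotZ (Real.pi / 2 : ℝ) * R).1 0 2 = -R.1 1 2 := by
  change ((rotZ (Real.pi / 2 : ℝ)).1 * R.1) 0 2 = _
  simp only [rotZ, Matrix.mul_apply, Fin.sum_univ_three, Real.Angle.cos_coe, Real.Angle.sin_coe]
  simp

theorem sum_sq_column_two (R : SO3) : R.1 0 2 ^ 2 + R.1 1 2 ^ 2 + R.1 2 2 ^ 2 = 1 := by
  have h := congrFun (congrFun (mem_SO3_iff.1 R.2).1 2) 2
  simp only [Matrix.mul_apply, Matrix.transpose_apply, Fin.sum_univ_three,
    Matrix.one_apply_eq] at h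
  linarith

/-- Infinitesimal invariance: `∫ z^j x` over the rotated column `(x, y, z)` of `rotY θ * R` does not
depend on `θ`. Its derivative at `θ = 0`, where `x' = z` and `z' = -x`, therefore vanishes. For `j =
0` the truncated exponent `j - 1` is harmless because of the factor `j`. -/
theorem integral_entry_pow_succ (j : ℕ) :
    ∫ R : SO3, R.1 2 2 ^ (j + 1) ∂haarSO3 =
      j * ∫ R : SO3, R.1 2 2 ^ (j - 1) * R.1 0 2 ^ 2 ∂haarSO3 := by
  have c2 := continuous_entry 2 2
  have c0 := continuous_entry 0 2
  set F : ℝ → SO3 → ℝ := fun θ R => (rotY θ * R).1 2 2 ^ j * (rotY θ * R).1 0 2 with hF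
  set F' : ℝ → SO3 → ℝ := fun θ R =>
    (j * (rotY θ * R).1 2 2 ^ (j - 1) * (-(rotY θ * R).1 0 2)) * (rotY θ * R).1 0 2 +
      (rotY θ * R).1 2 2 ^ j * (rotY θ * R).1 2 2 with hF'
  have hFc (θ : ℝ) : Continuous (F θ) := by
    simp only [hF, rotY_mul_zero_two, rotY_mul_two_two]; fun_prop
  have hFc' (θ : ℝ) : Continuous (F' θ) := by
    simp only [hF', rotY_mul_zero_two, rotY_mul_two_two]; fun_prop
  have hd (R : SO3) (θ : ℝ) : HasDerivAt (fun θ => F θ R) (F' θ R) θ := by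
    have h2 : HasDerivAt (fun θ : ℝ => (rotY θ * R).1 2 2) (-(rotY θ * R).1 0 2) θ := by
      simp only [rotY_mul_zero_two, rotY_mul_two_two]
      convert! ((Real.hasDerivAt_sin θ).neg.mul_const (R.1 0 2)).add
        ((Real.hasDerivAt_cos θ).mul_const (R.1 2 2)) using 1
      ring
    have h0 : HasDerivAt (fun θ : ℝ => (rotY θ * R).1 0 2) ((rotY θ * R).1 2 2) θ := by
      simp only [rotY_mul_zero_two, rotY_mul_two_two]
      exact ((Real.hasDerivAt_cos θ).mul_const (R.1 0 2)).add
        ((Real.hasDerivAt_sin θ).mul_const (R.1 2 2))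
    exact (h2.pow j).mul h0
  have hb (θ : ℝ) (R : SO3) : ‖F' θ R‖ ≤ (j : ℝ) + 1 := by
    have a0 := abs_apply_le_one (rotY θ * R) 0 2
    have a2 := abs_apply_le_one (rotY θ * R) 2 2
    refine (norm_add_le _ _).trans (add_le_add ?_ ?_)
    · simp only [Real.norm_eq_abs, abs_mul, abs_pow, abs_neg, Nat.abs_cast]
      calc _ ≤ (j : ℝ) * 1 * 1 * 1 := by gcongr; exact pow_le_one₀ (abs_nonneg _) a2
        _ = j := by ring
    · rw [← pow_succ, Real.norm_eq_abs, abs_pow]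
      exact pow_le_one₀ (abs_nonneg _) a2
  have key := (hasDerivAt_integral_of_dominated_loc_of_deriv_le (μ := haarSO3) (x₀ := (0 : ℝ))
    (bound := fun _ => (j : ℝ) + 1) Filter.univ_mem
    (Filter.Eventually.of_forall fun θ => (hFc θ).aestronglyMeasurable)
    (integrable_haarSO3_of_continuous (hFc 0)) (hFc' 0).aestronglyMeasurable
    (Filter.Eventually.of_forall fun R θ _ => hb θ R) (integrable_const _)
    (Filter.Eventually.of_forall fun R θ _ => hd R θ)).2
  have hconst : (fun θ => ∫ R, F θ R ∂haarSO3) = fun _ => ∫ R, F 0 R ∂haarSO3 := by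
    ext θ
    rw [show F θ = fun R => (fun R : SO3 => R.1 2 2 ^ j * R.1 0 2) (rotY θ * R) from rfl,
      show F 0 = fun R => (fun R : SO3 => R.1 2 2 ^ j * R.1 0 2) (rotY (0 : ℝ) * R) from rfl,
      integral_mul_left_eq_self, integral_mul_left_eq_self]
  rw [hconst] at key
  have h0 := key.unique (hasDerivAt_const _ _)
  have hF0 : F' 0 = fun R : SO3 => R.1 2 2 ^ (j + 1) - j * (R.1 2 2 ^ (j - 1) * R.1 0 2 ^ 2) := by
    ext R
    simp only [hF', rotY_mul_zero_two, rotY_mul_two_two]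
    simp; ring
  rw [hF0, integral_sub (integrable_haarSO3_of_continuous (by fun_prop))
    (integrable_haarSO3_of_continuous (by fun_prop)), integral_const_mul] at h0
  linarith

/-- A quarter turn about the `z`-axis exchanges the roles of `x²` and `y²`, and the column has norm
`1`; so `x²` may be replaced by `(1 - z²)/2` under the integral. -/
theorem integral_entry_pow_rec (j : ℕ) :
    ((j : ℝ) + 3) * ∫ R : SO3, R.1 2 2 ^ (j + 2) ∂haarSO3 =
      (j + 1) * ∫ R : SO3, R.1 2 2 ^ j ∂haarSO3 := by
  have c2 := continuous_entry 2 2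
  have c0 := continuous_entry 0 2
  have c1 := continuous_entry 1 2
  have h0 := integral_entry_pow_succ (j + 1)
  have h1 : ∫ R : SO3, R.1 2 2 ^ j * R.1 0 2 ^ 2 ∂haarSO3 =
      ∫ R : SO3, R.1 2 2 ^ j * R.1 1 2 ^ 2 ∂haarSO3 := by
    rw [← integral_mul_left_eq_self (fun R : SO3 => R.1 2 2 ^ j * R.1 0 2 ^ 2)
      (rotZ (Real.pi / 2 : ℝ))]
    simp only [rotZ_mul_two_two, rotZ_pi_div_two_mul_zero_two, neg_sq]
  have h2 : ∫ R : SO3, R.1 2 2 ^ j ∂haarSO3 =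
      ∫ R : SO3, R.1 2 2 ^ j * R.1 0 2 ^ 2 ∂haarSO3 +
        ∫ R : SO3, R.1 2 2 ^ j * R.1 1 2 ^ 2 ∂haarSO3 +
        ∫ R : SO3, R.1 2 2 ^ (j + 2) ∂haarSO3 := by
    rw [← integral_add, ← integral_add]
    · congr 1
      ext R
      linear_combination (-R.1 2 2 ^ j) * sum_sq_column_two R
    all_goals exact integrable_haarSO3_of_continuous (by fun_prop)
  simp only [Nat.add_sub_cancel, add_assoc, Nat.reduceAdd] at h0
  push_cast at h0
  rw [h2, ← h1]
  linear_combination 2 * h0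

theorem integral_entry_pow (j : ℕ) :
    ∫ R : SO3, R.1 2 2 ^ j ∂haarSO3 = 1 / 2 * ∫ x in (-1 : ℝ)..1, x ^ j := by
  rw [integral_pow]
  induction j using Nat.twoStepInduction with
  | zero => norm_num
  | one => simpa using integral_entry_pow_succ 0
  | more j ih _ =>
    have h := integral_entry_pow_rec j
    have e : (-1 : ℝ) ^ (j + 2 + 1) = (-1) ^ (j + 1) := by ring
    rw [ih] at h
    rw [e]
    push_cast at h ⊢
    have h3 : (j : ℝ) + 3 ≠ 0 := by positivity
    refine mul_left_cancel₀ h3 (h.trans ?_)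
    simp only [one_pow]
    field_simp
    ring

/-- The uniform distribution on `[-1, 1]`. -/
def uniformMeasure : Measure ℝ := (2⁻¹ : NNReal) • volume.restrict (Set.Ioc (-1) 1)

instance : IsFiniteMeasure uniformMeasure := by unfold uniformMeasure; infer_instance

theorem integral_uniformMeasure {E : Type*} [NormedAddCommGroup E] [NormedSpace ℝ E] (g : ℝ → E) :
    ∫ x, g x ∂uniformMeasure = (1 / 2 : ℝ) • ∫ x in (-1 : ℝ)..1, g x := by
  rw [uniformMeasure, integral_smul_nnreal_measure, intervalIntegral.integral_of_le (by norm_num)]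
  rw [NNReal.smul_def]; simp

/-- Archimedes' theorem: the entry `R₂₂` of a random rotation is uniformly distributed. -/
theorem map_entry_haarSO3 : haarSO3.map (fun R : SO3 => R.1 2 2) = uniformMeasure := by
  have c2 := continuous_entry 2 2
  have hm : Measurable fun R : SO3 => R.1 2 2 := c2.measurable
  have : IsProbabilityMeasure (haarSO3.map fun R : SO3 => R.1 2 2) :=
    Measure.isProbabilityMeasure_map hm.aemeasurable
  have hpoly (p : ℝ[X]) : ∫ R : SO3, p.eval (R.1 2 2) ∂haarSO3 =
      1 / 2 * ∫ x in (-1 : ℝ)..1, p.eval x := by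
    induction p using Polynomial.induction_on' with
    | add p q hp hq =>
      simp only [eval_add]
      rw [integral_add (integrable_haarSO3_of_continuous (by fun_prop))
        (integrable_haarSO3_of_continuous (by fun_prop)), hp, hq,
        intervalIntegral.integral_add (p.continuous.intervalIntegrable _ _)
        (q.continuous.intervalIntegrable _ _)]
      ring
    | monomial n a =>
      simp only [eval_monomial]
      rw [integral_const_mul, integral_entry_pow, intervalIntegral.integral_const_mul]
      ring
  -- Bounded continuous functions determine a finite measure. Both integrals only see `[-1, 1]`, so
  -- Weierstrass approximation reduces the claim to polynomials.
  refine ext_of_forall_integral_eq_of_IsFiniteMeasure fun f => ?_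
  rw [integral_map hm.aemeasurable f.continuous.aestronglyMeasurable, integral_uniformMeasure,
    smul_eq_mul]
  refine eq_of_forall_dist_le fun ε hε => ?_
  -- Each side contributes `ε / 2`: on the right the length `2` of the interval cancels the density
  -- `1 / 2`.
  obtain ⟨p, hp⟩ := exists_polynomial_near_of_continuousOn (-1) 1 f f.continuous.continuousOn
    (ε / 2) (by positivity)
  have h1 : |∫ R : SO3, f (R.1 2 2) ∂haarSO3 - ∫ R : SO3, p.eval (R.1 2 2) ∂haarSO3| ≤ ε / 2 := by
    have cf : Continuous fun R : SO3 => f (R.1 2 2) := f.continuous.comp c2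
    rw [← integral_sub (integrable_haarSO3_of_continuous cf)
      (integrable_haarSO3_of_continuous (by fun_prop))]
    rw [← Real.norm_eq_abs]
    refine (norm_integral_le_of_norm_le_const (C := ε / 2)
      (Filter.Eventually.of_forall fun R => ?_)).trans ?_
    · rw [Real.norm_eq_abs, abs_sub_comm]
      exact (hp _ (abs_le.1 (abs_apply_le_one R 2 2))).le
    · simp
  have h2 : |(∫ x in (-1 : ℝ)..1, f x) - ∫ x in (-1 : ℝ)..1, p.eval x| ≤ ε := by
    rw [← intervalIntegral.integral_sub (f.continuous.intervalIntegrable _ _)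
      (p.continuous.intervalIntegrable _ _)]
    rw [← Real.norm_eq_abs]
    refine (intervalIntegral.norm_integral_le_of_norm_le_const (C := ε / 2) fun x hx => ?_).trans ?_
    · rw [Set.uIoc_of_le (by norm_num)] at hx
      rw [Real.norm_eq_abs, abs_sub_comm]
      exact (hp _ (Set.Ioc_subset_Icc_self hx)).le
    · norm_num
  rw [hpoly] at h1
  rw [Real.dist_eq]
  rw [abs_le] at *
  constructor <;> linarith [h1.1, h1.2, h2.1, h2.2]

/-! ### Decay of the Legendre integrals of `(1 - x²)^(-1/4)` -/

/-- `1 / √(sin β)` as a function of `x = cos β`. -/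
def invSqrtSin (x : ℝ) : ℝ := 1 / √(√(1 - x ^ 2))

theorem invSqrtSin_sq (x : ℝ) : invSqrtSin x ^ 2 = 1 / √(1 - x ^ 2) := by
  rw [invSqrtSin, div_pow, Real.sq_sqrt (Real.sqrt_nonneg _), one_pow]

theorem measurable_invSqrtSin : Measurable invSqrtSin := by unfold invSqrtSin; fun_prop

theorem memLp_invSqrtSin : MemLp invSqrtSin 2 uniformMeasure := by
  refine (MemLp.smul_measure ?_ ENNReal.coe_ne_top :
    MemLp invSqrtSin 2 (((2⁻¹ : NNReal) : ENNReal) • volume.restrict (Set.Ioc (-1) 1)))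
  rw [memLp_two_iff_integrable_sq measurable_invSqrtSin.aestronglyMeasurable]
  simp only [invSqrtSin_sq]
  exact intervalIntegral.integrableOn_deriv_of_nonneg Real.continuous_arcsin.continuousOn
    (fun x hx => Real.hasDerivAt_arcsin hx.1.ne' hx.2.ne) fun x _ => by positivity

theorem intervalIntegrable_invSqrtSin : IntervalIntegrable invSqrtSin volume (-1) 1 := by
  rw [intervalIntegrable_iff_integrableOn_Ioc_of_le (by norm_num)]
  have h : Integrable invSqrtSin
      (((2⁻¹ : NNReal) : ENNReal) • volume.restrict (Set.Ioc (-1) 1)) :=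
    memLp_invSqrtSin.integrable one_le_two
  exact (integrable_smul_measure (by simp) ENNReal.coe_ne_top).1 h

/-- On `(-1, 1)` the integrand is the derivative of `(1 - x²)^(3/4) p(x)`, which vanishes at both
endpoints. -/
theorem integral_invSqrtSin_mul_eq_zero {p q : ℝ → ℝ} (hq : Continuous q)
    (hp : ∀ x, HasDerivAt p (deriv p x) x)
    (h : ∀ x, q x = (1 - x ^ 2) * deriv p x - 3 / 2 * x * p x) :
    ∫ x in (-1 : ℝ)..1, invSqrtSin x * q x = 0 := by
  have hpc : Continuous p := continuous_iff_continuousAt.2 fun x => (hp x).continuousAt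
  have key := intervalIntegral.integral_eq_sub_of_hasDerivAt_of_le (a := (-1 : ℝ)) (b := 1)
    (f := fun x => (1 - x ^ 2) ^ (3 / 4 : ℝ) * p x) (f' := fun x => invSqrtSin x * q x)
    (by norm_num) ?_ ?_ ?_
  · rw [key]; norm_num
  · refine Continuous.continuousOn (Continuous.mul ?_ hpc)
    exact Continuous.rpow_const (by fun_prop) fun _ => Or.inr (by norm_num)
  · intro x hx
    have hx0 : 0 < 1 - x ^ 2 := by nlinarith [hx.1, hx.2]
    have hg : (1 - x ^ 2) ^ (3 / 4 - 1 : ℝ) = invSqrtSin x := by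
      rw [invSqrtSin, Real.sqrt_eq_rpow, Real.sqrt_eq_rpow, ← Real.rpow_mul hx0.le, one_div,
        ← Real.rpow_neg hx0.le]
      norm_num
    have hg' : (1 - x ^ 2) ^ (3 / 4 : ℝ) = (1 - x ^ 2) * invSqrtSin x := by
      rw [← hg, mul_comm, ← Real.rpow_add_one hx0.ne']
      norm_num
    have hd : HasDerivAt (fun x : ℝ => 1 - x ^ 2) (-(2 * x)) x := by
      simpa using (hasDerivAt_pow 2 x).const_sub 1
    convert! (hd.rpow_const (p := 3 / 4) (Or.inl hx0.ne')).mul (hp x) using 1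
    rw [hg, hg', h]
    ring
  · exact intervalIntegrable_invSqrtSin.mul_continuousOn hq.continuousOn

/-- The integral of `1 / √(sin β)` against the Legendre polynomial `P_n`. -/
def legendreIntegral (n : ℕ) : ℝ := ∫ x in (-1 : ℝ)..1, invSqrtSin x * jacobiP n 0 0 x

theorem continuous_jacobiP (n : ℕ) : Continuous (jacobiP n 0 0) := by
  unfold jacobiP; fun_prop

theorem intervalIntegrable_invSqrtSin_mul {p : ℝ → ℝ} (hp : Continuous p) :
    IntervalIntegrable (fun x => invSqrtSin x * p x) volume (-1) 1 :=
  intervalIntegrable_invSqrtSin.mul_continuousOn hp.continuousOn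

theorem legendreIntegral_succ (n : ℕ) :
    ((n : ℝ) - 1 / 2) * ∫ x in (-1 : ℝ)..1, invSqrtSin x * (x * jacobiP n 0 0 x) =
      (n + 1) * legendreIntegral (n + 1) := by
  have c := continuous_jacobiP n
  have c' := continuous_jacobiP (n + 1)
  have h := integral_invSqrtSin_mul_eq_zero
    (q := fun x => (n - 1 / 2) * (x * jacobiP n 0 0 x) - (n + 1) * jacobiP (n + 1) 0 0 x)
    (by fun_prop) (hasDerivAt_jacobiP n) fun x => by
      rw [one_sub_sq_mul_deriv_jacobiP]; ring
  simp only [mul_sub, mul_left_comm (invSqrtSin _)] at h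
  rw [intervalIntegral.integral_sub, intervalIntegral.integral_const_mul,
    intervalIntegral.integral_const_mul] at h
  · simp only [legendreIntegral, mul_left_comm (invSqrtSin _)]
    linarith
  · simp only [← mul_left_comm (invSqrtSin _)]
    exact intervalIntegrable_invSqrtSin_mul (by fun_prop)
  · simp only [← mul_left_comm (invSqrtSin _)]
    exact intervalIntegrable_invSqrtSin_mul (by fun_prop)

theorem legendreIntegral_eq (n : ℕ) :
    ((n : ℝ) + 5 / 2) * ∫ x in (-1 : ℝ)..1, invSqrtSin x * (x * jacobiP (n + 1) 0 0 x) =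
      (n + 1) * legendreIntegral n := by
  have c := continuous_jacobiP n
  have c' := continuous_jacobiP (n + 1)
  have h := integral_invSqrtSin_mul_eq_zero
    (q := fun x => (n + 1) * jacobiP n 0 0 x - (n + 5 / 2) * (x * jacobiP (n + 1) 0 0 x))
    (by fun_prop) (hasDerivAt_jacobiP (n + 1)) fun x => by
      rw [one_sub_sq_mul_deriv_jacobiP_succ]; ring
  simp only [mul_sub, mul_left_comm (invSqrtSin _)] at h
  rw [intervalIntegral.integral_sub, intervalIntegral.integral_const_mul,
    intervalIntegral.integral_const_mul] at h
  · simp only [legendreIntegral, mul_left_comm (invSqrtSin _)]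
    linarith
  · simp only [← mul_left_comm (invSqrtSin _)]
    exact intervalIntegrable_invSqrtSin_mul (by fun_prop)
  · simp only [← mul_left_comm (invSqrtSin _)]
    exact intervalIntegrable_invSqrtSin_mul (by fun_prop)

/-- The integral of `w · x · Pₙ₊₁` occurs in both preceding relations and is eliminated. -/
theorem legendreIntegral_add_two (n : ℕ) :
    ((n : ℝ) + 2) * (n + 5 / 2) * legendreIntegral (n + 2) =
      (n + 1 / 2) * (n + 1) * legendreIntegral n := by
  have h1 := legendreIntegral_succ (n + 1)
  have h2 := legendreIntegral_eq n
  push_cast at h1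
  simp only [add_assoc, Nat.reduceAdd] at h1
  linear_combination (-((n : ℝ) + 5 / 2)) * h1 + (n + 1 / 2) * h2

/-- The recurrence ratio is about `1 - 3/n` per double step, which suggests `Iₙ ~ n^(-3/2)`. Indeed
`Iₙ² (n+1)³` is nonincreasing along each parity class, so the values at `0` and `1` bound it. -/
theorem exists_legendreIntegral_sq_le :
    ∃ C : ℝ, 0 ≤ C ∧ ∀ n : ℕ, legendreIntegral n ^ 2 * ((n : ℝ) + 1) ^ 3 ≤ C := by
  refine ⟨max (legendreIntegral 0 ^ 2) (legendreIntegral 1 ^ 2 * 8),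
    le_max_of_le_left (sq_nonneg _), fun n => ?_⟩
  induction n using Nat.twoStepInduction with
  | zero => simp
  | one => norm_num
  | more n ih _ =>
    refine le_trans ?_ ih
    have h := congrArg (· ^ 2) (legendreIntegral_add_two n)
    simp only [mul_pow] at h
    set A := legendreIntegral n ^ 2
    set B := legendreIntegral (n + 2) ^ 2
    have hA : 0 ≤ A := sq_nonneg _
    have hn : (0 : ℝ) ≤ n := Nat.cast_nonneg n
    have hpos : (0 : ℝ) < ((n : ℝ) + 2) ^ 2 * (n + 5 / 2) ^ 2 := by positivity
    refine le_of_mul_le_mul_left ?_ hpos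
    push_cast
    have e : ((n : ℝ) + 1 / 2) ^ 2 * (n + 3) ^ 3 ≤ (n + 1) * ((n + 2) ^ 2 * (n + 5 / 2) ^ 2) := by
      -- This polynomial is exactly the right side minus the left side.
      have : (0 : ℝ) ≤ 3 * (n : ℝ) ^ 3 + 19 * n ^ 2 + 36.25 * n + 18.25 := by positivity
      linarith
    calc _ = (((n : ℝ) + 1 / 2) ^ 2 * (n + 3) ^ 3) * ((n + 1) ^ 2 * A) := by
          linear_combination ((n : ℝ) + 3) ^ 3 * h
      _ ≤ ((n + 1) * ((n + 2) ^ 2 * (n + 5 / 2) ^ 2)) * ((n + 1) ^ 2 * A) := by gcongr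
      _ = _ := by ring

/-! ### Harmonic coefficients of the zonal function -/

theorem eulerRotation_two_two (α β γ : 𝕋) : (eulerRotation α β γ).1 2 2 = β.cos := by
  rw [eulerRotation_val]; simp

theorem cos_eulerAngles (R : SO3) : Real.cos (eulerAngles R).2.1 = R.1 2 2 := by
  conv_rhs => rw [← eulerRotation_eulerAngles R]
  rw [eulerRotation_two_two, Real.Angle.cos_coe]

theorem rotZ_mul_rotZ (α β : 𝕋) : rotZ α * rotZ β = rotZ (α + β) := by
  refine Subtype.ext ?_
  change (rotZ α).1 * (rotZ β).1 = (rotZ (α + β)).1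
  ext i j
  fin_cases i <;> fin_cases j <;>
    simp [rotZ, Matrix.mul_apply, Fin.sum_univ_three, Real.Angle.cos_add, Real.Angle.sin_add] <;>
    ring

theorem wignerD_rotZ_mul (n : ℕ) (k l : ℤ) (θ : ℝ) (R : SO3) :
    wignerD n k l (rotZ θ * R) = Complex.exp (-(Complex.I * k * θ)) * wignerD n k l R := by
  have h : rotZ θ * R = eulerRotation ((θ + (eulerAngles R).1 : ℝ) : 𝕋)
      ((eulerAngles R).2.1 : 𝕋) ((eulerAngles R).2.2 : 𝕋) := by
    conv_lhs => rw [← eulerRotation_eulerAngles R]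
    simp only [eulerRotation, ← mul_assoc, rotZ_mul_rotZ, Real.Angle.coe_add]
  rw [h, wignerD_eulerRotation _ _ _ _ _ _ (eulerAngles_mem R), wignerD, wignerDEuler,
    wignerDEuler]
  push_cast
  rw [mul_add, neg_add, Complex.exp_add]
  ring

theorem wignerD_mul_rotZ (n : ℕ) (k l : ℤ) (θ : ℝ) (R : SO3) :
    wignerD n k l (R * rotZ θ) = Complex.exp (-(Complex.I * l * θ)) * wignerD n k l R := by
  have h : R * rotZ θ = eulerRotation ((eulerAngles R).1 : 𝕋)
      ((eulerAngles R).2.1 : 𝕋) (((eulerAngles R).2.2 + θ : ℝ) : 𝕋) := by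
    conv_lhs => rw [← eulerRotation_eulerAngles R]
    simp only [eulerRotation, mul_assoc, rotZ_mul_rotZ, Real.Angle.coe_add]
  rw [h, wignerD_eulerRotation _ _ _ _ _ _ (eulerAngles_mem R), wignerD, wignerDEuler,
    wignerDEuler]
  push_cast
  rw [mul_add, neg_add, Complex.exp_add]
  ring

theorem exp_neg_I_mul_pi_div {k : ℤ} (hk : k ≠ 0) :
    Complex.exp (-(Complex.I * k * (Real.pi / k : ℝ))) = -1 := by
  have hk' : (k : ℂ) ≠ 0 := Int.cast_ne_zero.2 hk
  have : -(Complex.I * k * (Real.pi / k : ℝ)) = -(Real.pi * Complex.I) := by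
    push_cast; field_simp
  rw [this, Complex.exp_neg, Complex.exp_pi_mul_I]
  norm_num

/-- Translation by the rotation of angle `π / k` fixes `f` and flips the sign of `D_n^{k,l}`, so the
coefficient equals its own negative. -/
theorem harmCoeff_eq_zero_of_left {f : SO3 → ℂ} (hf : ∀ (θ : ℝ) R, f (rotZ θ * R) = f R) (n : ℕ)
    {k : ℤ} (hk : k ≠ 0) (l : ℤ) : harmCoeff f n k l = 0 := by
  have h := integral_mul_left_eq_self (μ := haarSO3)
    (fun R => f R * (starRingEnd ℂ) (wignerD n k l R)) (rotZ (Real.pi / k : ℝ))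
  simp only [hf, wignerD_rotZ_mul, exp_neg_I_mul_pi_div hk, neg_mul, one_mul, map_neg, mul_neg,
    integral_neg] at h
  exact neg_eq_self.1 h

theorem harmCoeff_eq_zero_of_right {f : SO3 → ℂ} (hf : ∀ (θ : ℝ) R, f (R * rotZ θ) = f R) (n : ℕ)
    (k : ℤ) {l : ℤ} (hl : l ≠ 0) : harmCoeff f n k l = 0 := by
  have h := integral_mul_right_eq_self (μ := haarSO3)
    (fun R => f R * (starRingEnd ℂ) (wignerD n k l R)) (rotZ (Real.pi / l : ℝ))
  simp only [hf, wignerD_mul_rotZ, exp_neg_I_mul_pi_div hl, neg_mul, one_mul, map_neg, mul_neg,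
    integral_neg] at h
  exact neg_eq_self.1 h

theorem wignerD_zero_zero (n : ℕ) (R : SO3) :
    wignerD n 0 0 R = ((√(2 * n + 1) * jacobiP n 0 0 (R.1 2 2) : ℝ) : ℂ) := by
  have h : 2 * n - n = n := by omega
  simp [wignerD, wignerDEuler, wignerd, cos_eulerAngles, h]

/-- The zonal function `R ↦ 1 / √(sin β)`. -/
def zonalInvSqrtSin (R : SO3) : ℂ := (invSqrtSin (R.1 2 2) : ℝ)

theorem memLp_zonalInvSqrtSin : MemLp zonalInvSqrtSin 2 haarSO3 := by
  have h := memLp_invSqrtSin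
  rw [← map_entry_haarSO3] at h
  exact ((memLp_map_measure_iff measurable_invSqrtSin.aestronglyMeasurable
    (continuous_entry 2 2).measurable.aemeasurable).1 h).ofReal

theorem harmCoeff_zonalInvSqrtSin (n : ℕ) :
    harmCoeff zonalInvSqrtSin n 0 0 = ((√(2 * n + 1) * (1 / 2 * legendreIntegral n) : ℝ) : ℂ) := by
  have h (R : SO3) : zonalInvSqrtSin R * (starRingEnd ℂ) (wignerD n 0 0 R) =
      ((√(2 * n + 1) * (invSqrtSin (R.1 2 2) * jacobiP n 0 0 (R.1 2 2)) : ℝ) : ℂ) := by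
    rw [wignerD_zero_zero, Complex.conj_ofReal, zonalInvSqrtSin, ← Complex.ofReal_mul]
    congr 1; ring
  simp only [harmCoeff, h]
  have hm : Measurable fun x => invSqrtSin x * jacobiP n 0 0 x :=
    measurable_invSqrtSin.mul (continuous_jacobiP n).measurable
  have hI : ∫ R : SO3, invSqrtSin (R.1 2 2) * jacobiP n 0 0 (R.1 2 2) ∂haarSO3 =
      1 / 2 * legendreIntegral n := by
    rw [← integral_map (φ := fun R : SO3 => R.1 2 2)
      (continuous_entry 2 2).measurable.aemeasurable hm.aestronglyMeasurable, map_entry_haarSO3,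
      integral_uniformMeasure, smul_eq_mul, legendreIntegral]
  rw [← hI, ← integral_const_mul]
  exact integral_ofReal (𝕜 := ℂ)

/-! ### Sobolev regularity -/

theorem memSobolevSO3_zonalInvSqrtSin {s : ℝ} (hs : s < 1 / 2) :
    MemSobolevSO3 s zonalInvSqrtSin := by
  refine ⟨memLp_zonalInvSqrtSin, ?_⟩
  let i : ℕ → HarmIndex := fun n => ⟨(n, 0, 0), by simp⟩
  have hi : Function.Injective i := fun m n h => congrArg (fun p : HarmIndex => p.1.1) h
  rw [← hi.summable_iff]
  · obtain ⟨C, hC, hle⟩ := exists_legendreIntegral_sq_le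
    -- Negative `s` is replaced by `0`: a nonnegative exponent makes the power monotone in the base
    -- `1 + n(n+1) ≤ (n+1)²`.
    set t := max s 0
    have ht0 : 0 ≤ t := le_max_right _ _
    have ht1 : 2 * t - 2 < -1 := by
      have : t < 1 / 2 := max_lt hs (by norm_num)
      linarith
    have hsum : Summable fun n : ℕ => C / 2 * ((n : ℝ) + 1) ^ (2 * t - 2) := by
      refine Summable.mul_left _ ?_
      simpa using (summable_nat_add_iff 1).2 (Real.summable_nat_rpow.2 ht1)
    refine Summable.of_nonneg_of_le (fun n => ?_) (fun n => ?_) hsum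
    · have : (0 : ℝ) ≤ 1 + (n : ℝ) * (n + 1) := by positivity
      exact mul_nonneg (Real.rpow_nonneg this _) (sq_nonneg _)
    have hn : (0 : ℝ) ≤ n := Nat.cast_nonneg n
    have hn1 : (0 : ℝ) < (n : ℝ) + 1 := by positivity
    have h1 : (1 + (n : ℝ) * (n + 1)) ^ s ≤ ((n : ℝ) + 1) ^ (2 * t) :=
      calc (1 + (n : ℝ) * (n + 1)) ^ s ≤ (1 + (n : ℝ) * (n + 1)) ^ t :=
            Real.rpow_le_rpow_of_exponent_le (by nlinarith) (le_max_left _ _)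
        _ ≤ (((n : ℝ) + 1) ^ 2) ^ t := Real.rpow_le_rpow (by positivity) (by nlinarith) ht0
        _ = ((n : ℝ) + 1) ^ (2 * t) := by
            rw [← Real.rpow_natCast, ← Real.rpow_mul hn1.le]; norm_num
    -- The square is `(2n+1)/4 · Iₙ²`; bounding `2n+1` by `2(n+1)` costs one of the three powers of
    -- `n+1` and leaves `C / 2`.
    have h2 : ‖harmCoeff zonalInvSqrtSin n 0 0‖ ^ 2 ≤ C / 2 * (((n : ℝ) + 1) ^ 2)⁻¹ := by
      rw [harmCoeff_zonalInvSqrtSin, Complex.norm_real, Real.norm_eq_abs, sq_abs, mul_pow,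
        Real.sq_sqrt (by positivity), mul_pow, ← div_eq_mul_inv, le_div_iff₀ (by positivity)]
      have := hle n
      have h3 : (2 * (n : ℝ) + 1) * (legendreIntegral n ^ 2 * (n + 1) ^ 2) ≤
          (2 * (n + 1)) * (legendreIntegral n ^ 2 * (n + 1) ^ 2) := by gcongr; linarith
      linarith
    calc _ ≤ ((n : ℝ) + 1) ^ (2 * t) * (C / 2 * (((n : ℝ) + 1) ^ 2)⁻¹) :=
          mul_le_mul h1 h2 (by positivity) (by positivity)
      _ = C / 2 * ((n : ℝ) + 1) ^ (2 * t - 2) := by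
          rw [Real.rpow_sub hn1, Real.rpow_two]; ring
  · rintro ⟨⟨n, k, l⟩, hp⟩ hmem
    have : harmCoeff zonalInvSqrtSin n k l = 0 := by
      by_cases hk : k = 0
      · by_cases hl : l = 0
        · subst hk hl
          exact absurd ⟨n, rfl⟩ hmem
        · exact harmCoeff_eq_zero_of_right
            (fun θ R => by rw [zonalInvSqrtSin, mul_rotZ_two_two, zonalInvSqrtSin]) n k hl
      · exact harmCoeff_eq_zero_of_left
          (fun θ R => by rw [zonalInvSqrtSin, rotZ_mul_two_two, zonalInvSqrtSin]) n hk l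
    simp [this]

/-! ### Failure of square integrability on the torus -/

instance : IsFiniteMeasure (volume : Measure 𝕋) :=
  haveI : Fact (0 < 2 * Real.pi) := ⟨Real.two_pi_pos⟩
  inferInstanceAs (IsFiniteMeasure (volume : Measure (AddCircle (2 * Real.pi))))

theorem measurePreserving_coe_angle :
    MeasurePreserving ((↑) : ℝ → 𝕋) (volume.restrict (Set.Ioc 0 (2 * Real.pi))) volume := by
  have : Fact (0 < 2 * Real.pi) := ⟨Real.two_pi_pos⟩
  simpa using! AddCircle.measurePreserving_mk (2 * Real.pi) 0

/-- Lets an almost-everywhere statement about slices supply an actual slice. -/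
instance : (ae (volume : Measure 𝕋)).NeBot := by
  rw [ae_neBot, ← measurePreserving_coe_angle.map_eq, Ne,
    Measure.map_eq_zero_iff measurePreserving_coe_angle.measurable.aemeasurable,
    Measure.restrict_eq_zero]
  simp [Real.pi_pos]

/-- On `(0, 1]` the function is `1 / sin β ≥ 1 / β`, and `1 / β` is not integrable at `0`. -/
theorem not_integrable_invSqrtSin_cos_sq :
    ¬ Integrable (fun β : 𝕋 => invSqrtSin β.cos ^ 2) volume := by
  intro h
  have h1 : IntegrableOn (fun β : ℝ => invSqrtSin (Real.cos β) ^ 2) (Set.Ioc 0 1) volume := by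
    have := measurePreserving_coe_angle.integrable_comp_of_integrable h
    refine IntegrableOn.mono_set (t := Set.Ioc 0 (2 * Real.pi)) this (Set.Ioc_subset_Ioc_right ?_)
    linarith [Real.pi_gt_three]
  have h2 : IntervalIntegrable (fun x : ℝ => x⁻¹) volume 0 1 := by
    rw [intervalIntegrable_iff_integrableOn_Ioc_of_le zero_le_one]
    refine Integrable.mono' h1 measurable_inv.aestronglyMeasurable ?_
    filter_upwards [ae_restrict_mem measurableSet_Ioc] with x hx
    have hs : 0 < Real.sin x :=
      Real.sin_pos_of_pos_of_lt_pi hx.1 (by linarith [hx.2, Real.pi_gt_three])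
    have e : 1 - Real.cos x ^ 2 = Real.sin x ^ 2 := by linarith [Real.sin_sq_add_cos_sq x]
    rw [invSqrtSin_sq, e, Real.sqrt_sq hs.le, Real.norm_of_nonneg (inv_nonneg.2 hx.1.le), one_div]
    exact inv_anti₀ hs (Real.sin_lt hx.1).le
  simp [intervalIntegrable_inv_iff] at h2

/-- By Fubini, integrability of the square would pass to almost every slice with `α` and `γ` fixed,
leaving the one-variable function of `β`. -/
theorem not_memLp_zonalInvSqrtSin_comp_phiSO3 :
    ¬ MemLp (zonalInvSqrtSin ∘ phiSO3) 2 (volume : Measure (𝕋 × 𝕋 × 𝕋)) := by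
  intro h
  have h1 := h.integrable_norm_pow two_ne_zero
  have e (x : 𝕋 × 𝕋 × 𝕋) : ‖(zonalInvSqrtSin ∘ phiSO3) x‖ ^ 2 = invSqrtSin x.2.1.cos ^ 2 := by
    rw [Function.comp_apply, zonalInvSqrtSin, phiSO3, eulerRotation_two_two, Complex.norm_real,
      Real.norm_eq_abs, sq_abs]
  simp only [e] at h1
  rw [Measure.volume_eq_prod] at h1
  obtain ⟨α, h2⟩ := h1.prod_right_ae.exists
  rw [Measure.volume_eq_prod] at h2
  obtain ⟨γ, h3⟩ := h2.prod_left_ae.exists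
  exact not_integrable_invSqrtSin_cos_sq h3

theorem eq_zonalInvSqrtSin {f : SO3 → ℂ}
    (hf : ∀ α β γ : ℝ, β ∈ Set.Icc 0 Real.pi →
      f (eulerRotation (α : 𝕋) (β : 𝕋) (γ : 𝕋)) =
        if β ∉ ({0, Real.pi} : Set ℝ) then (((1 / √(Real.sin β) : ℝ)) : ℂ) else 0) :
    f = zonalInvSqrtSin := by
  ext R
  have hβ := eulerAngles_mem R
  have h := hf (eulerAngles R).1 _ (eulerAngles R).2.2 hβ
  rw [eulerRotation_eulerAngles] at h
  rw [h, zonalInvSqrtSin, invSqrtSin, ← cos_eulerAngles]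
  have e : √(1 - Real.cos (eulerAngles R).2.1 ^ 2) = Real.sin (eulerAngles R).2.1 := by
    rw [← Real.sin_sq, Real.sqrt_sq (Real.sin_nonneg_of_mem_Icc hβ)]
  rw [e]
  split_ifs with hs
  -- At the poles `sin β = 0`, and the convention `1 / 0 = 0` gives the prescribed value `0`.
  · rcases hs with hs | hs <;> rw [hs] <;> simp
  · rfl

end RotDFS

end

theorem mainTheorem5 (f : SO3 → ℂ)
    (hf : ∀ α β γ : ℝ, β ∈ Set.Icc 0 Real.pi →
      f (eulerRotation (α : 𝕋) (β : 𝕋) (γ : 𝕋)) =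
        if β ∉ ({0, Real.pi} : Set ℝ) then (((1 / √(Real.sin β) : ℝ)) : ℂ) else 0) :
    (∀ s : ℝ, s < 1 / 2 → MemSobolevSO3 s f) ∧
      ¬ MemLp (f ∘ phiSO3) 2 (volume : Measure (𝕋 × 𝕋 × 𝕋)) := by
  rw [eq_zonalInvSqrtSin hf]
  exact ⟨fun s hs => memSobolevSO3_zonalInvSqrtSin hs, not_memLp_zonalInvSqrtSin_comp_phiSO3⟩
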